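/- For $n\in\mathbb N$ let $\mathcal M_n$ be the full algebra of complex $n\times n$ matrices, acting on the Hilbert space $\mathbb C^n$. Let $\mathcal A$ and $\mathcal B$ be $*$-subalgebras of $\mathcal M_d$ (complex linear subspaces closed under multiplication and under the adjoint $a\mapsto a^\dagger$; they are not assumed to contain the identity matrix), and let $\mathcal A\vee\mathcal B$ denote the smallest $*$-subalgebra of $\mathcal M_d$ containing both (as $\mathcal A$ and $\mathcal B$ are closed under the adjoint, this is also the smallest subalgebra containing both). Suppose that (i) (independence) $ab=ba$ for all $a\in\mathcal A$ and $b\in\mathcal B$; (ii) (completeness) $\mathcal A\vee\mathcal B=\mathcal M_d$, and $\mathcal A\otimes\mathcal B$ and $\mathcal A\vee\mathcal B$ are isomorphic as complex algebras. Then $\mathcal A$ and $\mathcal B$ induce a tensor product structure on $\mathbb C^d$: there exist $k,l\in\mathbb N$ with $d=k\cdot l$ and a unitary map $U:\mathbb C^k\otimes\mathbb C^l\to\mathbb C^d$ such that $$\mathcal A=U(\mathcal M_k\otimes\mathbb I_l)U^\dagger\quad\text{and}\quad\mathcal B=U(\mathbb I_k\otimes\mathcal M_l)U^\dagger .$$ In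 particular, $\mathcal A$ and $\mathcal B$ are $*$-isomorphic to $\mathcal M_k$ and $\mathcal M_l$ respectively. -/

import Mathlib

open scoped TensorProduct

/-- `M_n`, the full algebra of complex `n × n` matrices, acting on the Hilbert space `ℂ^n`. -/
abbrev MatAlg (n : ℕ) : Type := Matrix (Fin n) (Fin n) ℂ

/-- The `n`-dimensional Hilbert space `ℂ^n` with its standard inner product. -/
abbrev HilbC (n : ℕ) : Type := EuclideanSpace ℂ (Fin n)

/-- The matrix in `M_d` of the operator `U T U†` on `ℂ^d`, for a unitary map
`U : ℂ^k ⊗ ℂ^l → ℂ^d` and an operator `T` on `ℂ^k ⊗ ℂ^l`.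
The adjoint of the unitary map `U` is its inverse. -/
noncomputable def conjOp {d k l : ℕ} (U : (HilbC k ⊗[ℂ] HilbC l) ≃ₗᵢ[ℂ] HilbC d)
    (T : (HilbC k ⊗[ℂ] HilbC l) →ₗ[ℂ] (HilbC k ⊗[ℂ] HilbC l)) : MatAlg d :=
  Matrix.toEuclideanLin.symm
    (U.toLinearEquiv.toLinearMap ∘ₗ T ∘ₗ U.symm.toLinearEquiv.toLinearMap)

/-- The set `U (M_k ⊗ 𝕀_l) U†` of matrices in `M_d`. -/
def leftFactor {d k l : ℕ} (U : (HilbC k ⊗[ℂ] HilbC l) ≃ₗᵢ[ℂ] HilbC d) : Set (MatAlg d) :=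
  Set.range fun X : MatAlg k =>
    conjOp U (TensorProduct.map (Matrix.toEuclideanLin X) LinearMap.id)

/-- The set `U (𝕀_k ⊗ M_l) U†` of matrices in `M_d`. -/
def rightFactor {d k l : ℕ} (U : (HilbC k ⊗[ℂ] HilbC l) ≃ₗᵢ[ℂ] HilbC d) : Set (MatAlg d) :=
  Set.range fun Y : MatAlg l =>
    conjOp U (TensorProduct.map LinearMap.id (Matrix.toEuclideanLin Y))

/-! ### Schur's lemma and the multiplicity space of an irreducible subspace. -/

section CommutingOperators

variable {E : Type*} [NormedAddCommGroup E] [InnerProductSpace ℂ E] [FiniteDimensional ℂ E]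

/-! Let `V` be a minimal nonzero `A`-invariant subspace of `ℂ^d` and `W` the space of
`A`-intertwiners `V → ℂ^d`. By Schur's lemma `w† w'` is a scalar for `w, w' ∈ W`; this scalar is an
inner product on `W` that makes `v ⊗ w ↦ w v` an isometry (`inner_intertwiners`). Here `A` acts on
`V` alone, and `B`, commuting with `A`, acts on `W` alone by composition. The image is invariant
under both, hence is all of `ℂ^d` because `A ⊔ B = ⊤` (`exists_orthonormalBasis_prod_of_commute`).
So `A` and `B` lie in the two tensor factors, of dimensions `k²` and `l²`. The isomorphism with `A ⊗
B` gives `dim A · dim B = d² = k² l²`, which forces both inclusions to be equalities. -/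

/-- A nontrivial finite-dimensional space has a minimal nonzero subspace invariant under a given
set of operators. -/
theorem exists_minimal_invariant_submodule [Nontrivial E] (s : Set (E →ₗ[ℂ] E)) :
    ∃ V : Submodule ℂ E, V ≠ ⊥ ∧ (∀ a ∈ s, ∀ v ∈ V, a v ∈ V) ∧
      ∀ S : Submodule ℂ E, S ≠ ⊥ → (∀ a ∈ s, ∀ v ∈ S, a v ∈ S) → S ≤ V → S = V := by
  obtain ⟨V, ⟨hV, hVs⟩, hmin⟩ := (wellFounded_lt (α := Submodule ℂ E)).has_min
    {V | V ≠ ⊥ ∧ ∀ a ∈ s, ∀ v ∈ V, a v ∈ V} ⟨⊤, top_ne_bot, fun _ _ _ _ => Submodule.mem_top⟩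
  exact ⟨V, hV, hVs, fun S hS hSs hle => by_contra fun hne =>
    hmin S ⟨hS, hSs⟩ (lt_of_le_of_ne hle hne)⟩

/-- **Schur's lemma** for a minimal invariant subspace. -/
theorem exists_eq_smul_of_commute_of_minimal {s : Set (E →ₗ[ℂ] E)} {V : Submodule ℂ E}
    (hV : V ≠ ⊥) (hVs : ∀ a ∈ s, ∀ v ∈ V, a v ∈ V)
    (hmin : ∀ S : Submodule ℂ E, S ≠ ⊥ → (∀ a ∈ s, ∀ v ∈ S, a v ∈ S) → S ≤ V → S = V)
    (T : V →ₗ[ℂ] V)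
    (hT : ∀ a (ha : a ∈ s) (v : V), (T ⟨a v, hVs a ha v v.2⟩ : E) = a (T v)) :
    ∃ c : ℂ, ∀ v, T v = c • v := by
  have : Nontrivial V := Submodule.nontrivial_iff_ne_bot.2 hV
  obtain ⟨c, hc⟩ := Module.End.exists_eigenvalue T
  refine ⟨c, fun v => ?_⟩
  have key : (Module.End.eigenspace T c).map V.subtype = V := by
    apply hmin
    · intro h
      exact hc <| Submodule.map_injective_of_injective V.injective_subtype <|
        h.trans (Submodule.map_bot _).symm
    · rintro a ha _ ⟨v, hv, rfl⟩
      refine ⟨⟨a v, hVs a ha v v.2⟩, ?_, rfl⟩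
      have hv' := Module.End.mem_eigenspace_iff.1 hv
      refine Module.End.mem_eigenspace_iff.2 (Subtype.ext ?_)
      rw [hT a ha, hv']
      simp
    · exact Submodule.map_subtype_le _ _
  have hv : (v : E) ∈ (Module.End.eigenspace T c).map V.subtype := key.ge v.2
  obtain ⟨u, hu, huv⟩ := hv
  obtain rfl : u = v := Subtype.ext huv
  exact Module.End.mem_eigenspace_iff.1 hu

/-- The maps from an invariant subspace to the whole space that commute with a set of operators. -/
def intertwiners {s : Set (E →ₗ[ℂ] E)} {V : Submodule ℂ E}
    (hVs : ∀ a ∈ s, ∀ v ∈ V, a v ∈ V) : Submodule ℂ (V →ₗ[ℂ] E) where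
  carrier := {w | ∀ a (ha : a ∈ s) (v : V), w ⟨a v, hVs a ha v v.2⟩ = a (w v)}
  add_mem' h₁ h₂ a ha v := by simp [h₁ a ha v, h₂ a ha v]
  zero_mem' a ha v := by simp
  smul_mem' c w h a ha v := by simp [h a ha v]

/-- Intertwiners from a minimal invariant subspace of a self-adjoint set of operators are
multiples of isometries, and the multiples are read off at a unit vector. -/
theorem inner_intertwiners {s : Set (E →ₗ[ℂ] E)} (hs : ∀ a ∈ s, LinearMap.adjoint a ∈ s)
    {V : Submodule ℂ E} (hV : V ≠ ⊥) (hVs : ∀ a ∈ s, ∀ v ∈ V, a v ∈ V)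
    (hmin : ∀ S : Submodule ℂ E, S ≠ ⊥ → (∀ a ∈ s, ∀ v ∈ S, a v ∈ S) → S ≤ V → S = V)
    {w w' : V →ₗ[ℂ] E} (hw : w ∈ intertwiners hVs) (hw' : w' ∈ intertwiners hVs)
    {v₀ : V} (hv₀ : ‖v₀‖ = 1) (u v : V) :
    inner ℂ (w u) (w' v) = inner ℂ (w v₀) (w' v₀) * inner ℂ u v := by
  -- The operator `w† w'` on `V` commutes with `a ∈ s`: `w'` intertwines `a`, and `w` intertwines
  -- `a†`, which is again in `s`.
  obtain ⟨c, hc⟩ := exists_eq_smul_of_commute_of_minimal hV hVs hmin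
    (LinearMap.adjoint w ∘ₗ w') fun a ha v => by
      have : (LinearMap.adjoint w ∘ₗ w') ⟨a v, hVs a ha v v.2⟩ =
          ⟨a ((LinearMap.adjoint w ∘ₗ w') v), hVs a ha _ (Subtype.prop _)⟩ := by
        refine ext_inner_left ℂ fun u => ?_
        have h₁ := hw _ (hs a ha) u
        rw [LinearMap.comp_apply, LinearMap.adjoint_inner_right, hw' a ha,
          ← LinearMap.adjoint_inner_left, ← h₁, ← LinearMap.adjoint_inner_right,
          Submodule.coe_inner, Submodule.coe_inner, LinearMap.adjoint_inner_left]
        rfl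
      rw [this]
  have h : ∀ u v, inner ℂ (w u) (w' v) = c * inner ℂ u v := fun u v => by
    rw [← LinearMap.adjoint_inner_right, ← LinearMap.comp_apply, hc, inner_smul_right]
  rw [h u v, h v₀ v₀, inner_self_eq_norm_sq_to_K, hv₀]
  simp

/-- Two commuting sets of operators, one of them self-adjoint, that act jointly irreducibly act on
the two factors of a tensor product basis. -/
theorem exists_orthonormalBasis_prod_of_commute [Nontrivial E] {s t : Set (E →ₗ[ℂ] E)}
    (hs : ∀ a ∈ s, LinearMap.adjoint a ∈ s) (hst : ∀ a ∈ s, ∀ b ∈ t, ∀ x, a (b x) = b (a x))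
    (hirr : ∀ S : Submodule ℂ E, S ≠ ⊥ → (∀ a ∈ s, ∀ v ∈ S, a v ∈ S) →
      (∀ b ∈ t, ∀ v ∈ S, b v ∈ S) → S = ⊤) :
    ∃ (k l : ℕ) (e : OrthonormalBasis (Fin k × Fin l) ℂ E),
      (∀ a ∈ s, ∃ X : Matrix (Fin k) (Fin k) ℂ, ∀ i j, a (e (i, j)) = ∑ m, X m i • e (m, j)) ∧
      (∀ b ∈ t, ∃ Y : Matrix (Fin l) (Fin l) ℂ, ∀ i j, b (e (i, j)) = ∑ m, Y m j • e (i, m)) := by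
  obtain ⟨V, hV, hVs, hmin⟩ := exists_minimal_invariant_submodule s
  have : Nontrivial V := Submodule.nontrivial_iff_ne_bot.2 hV
  obtain ⟨v₀, hv₀⟩ := exists_norm_eq V zero_le_one
  have hinner := fun (w w' : intertwiners hVs) =>
    inner_intertwiners hs hV hVs hmin w.2 w'.2 hv₀
  -- Evaluation at `v₀` is injective and carries the inner product of `E` back to the intertwiners.
  let ev : intertwiners hVs →ₗ[ℂ] E := LinearMap.applyₗ v₀ ∘ₗ (intertwiners hVs).subtype
  have hev : Function.Injective ev := by
    refine (injective_iff_map_eq_zero ev).2 fun w hw => Subtype.ext (LinearMap.ext fun u => ?_)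
    have h := hinner w w u u
    rw [show w.1 v₀ = 0 from hw, inner_zero_left, zero_mul] at h
    exact inner_self_eq_zero.1 h
  let f := LinearEquiv.ofInjective ev hev
  let p := stdOrthonormalBasis ℂ V
  let q := stdOrthonormalBasis ℂ (LinearMap.range ev)
  let r := q.toBasis.map f.symm
  have hr : ∀ j, (r j).1 v₀ = q j := fun j =>
    congrArg Subtype.val (show f (r j) = q j by simp [r])
  let g : Fin _ × Fin _ → E := fun x => (r x.2).1 (p x.1)
  have hg : Orthonormal ℂ g := by
    rw [orthonormal_iff_ite]
    rintro ⟨i, j⟩ ⟨i', j'⟩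
    simp only [g]
    rw [hinner, hr, hr, ← Submodule.coe_inner, orthonormal_iff_ite.1 q.orthonormal,
      orthonormal_iff_ite.1 p.orthonormal]
    by_cases h₁ : i = i' <;> by_cases h₂ : j = j' <;> simp [h₁, h₂]
  have hsg : ∀ a ∈ s, ∃ X : Matrix _ _ ℂ, ∀ i j, a (g (i, j)) = ∑ m, X m i • g (m, j) := by
    intro a ha
    -- The matrix of `a` on `V`; it does not depend on `j` since each `r j` intertwines `a`.
    refine ⟨Matrix.of fun m i => p.repr ⟨a (p i), hVs a ha _ (p i).2⟩ m, fun i j => ?_⟩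
    simp only [g, Matrix.of_apply]
    rw [← (r j).2 a ha]
    conv_lhs => rw [← p.sum_repr ⟨a (p i), hVs a ha _ (p i).2⟩]
    simp only [map_sum, map_smul]
  have htg : ∀ b ∈ t, ∃ Y : Matrix _ _ ℂ, ∀ i j, b (g (i, j)) = ∑ m, Y m j • g (i, m) := by
    intro b hb
    have hmem : ∀ j, b ∘ₗ (r j).1 ∈ intertwiners hVs := fun j a ha v => by
      simp [(r j).2 a ha v, hst a ha b hb]
    refine ⟨Matrix.of fun m j => r.repr ⟨b ∘ₗ (r j).1, hmem j⟩ m, fun i j => ?_⟩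
    have h := congrArg (LinearMap.applyₗ (p i) ∘ₗ (intertwiners hVs).subtype)
      (r.sum_repr ⟨b ∘ₗ (r j).1, hmem j⟩)
    rw [map_sum] at h
    exact h.symm
  have hspan : ∀ c : E →ₗ[ℂ] E, (∀ x, c (g x) ∈ Submodule.span ℂ (Set.range g)) →
      ∀ v ∈ Submodule.span ℂ (Set.range g), c v ∈ Submodule.span ℂ (Set.range g) := by
    intro c hc v hv
    have : Submodule.span ℂ (Set.range g) ≤ (Submodule.span ℂ (Set.range g)).comap c :=
      Submodule.span_le.2 (by rintro _ ⟨x, rfl⟩; exact hc x)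
    exact this hv
  have htop : Submodule.span ℂ (Set.range g) = ⊤ := by
    refine hirr _ ?_ (fun a ha => hspan a ?_) (fun b hb => hspan b ?_)
    -- The inclusion of `V` is a nonzero intertwiner, so neither index set is empty.
    · have hincl : V.subtype ∈ intertwiners hVs := fun a ha v => rfl
      have hne : Nontrivial (intertwiners hVs) := by
        refine ⟨⟨⟨_, hincl⟩, 0, fun h => ?_⟩⟩
        have h' := congrArg (fun w : intertwiners hVs => w.1 v₀) h
        have h0 : v₀ = 0 := Subtype.ext h'
        simp [h0] at hv₀
      obtain ⟨i⟩ := p.toBasis.index_nonempty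
      obtain ⟨j⟩ := r.index_nonempty
      exact fun h => hg.ne_zero (i, j) ((Submodule.eq_bot_iff _).1 h _
        (Submodule.subset_span ⟨_, rfl⟩))
    · rintro ⟨i, j⟩
      obtain ⟨X, hX⟩ := hsg a ha
      rw [hX]
      exact Submodule.sum_smul_mem _ _ fun m _ => Submodule.subset_span ⟨_, rfl⟩
    · rintro ⟨i, j⟩
      obtain ⟨Y, hY⟩ := htg b hb
      rw [hY]
      exact Submodule.sum_smul_mem _ _ fun m _ => Submodule.subset_span ⟨_, rfl⟩
  refine ⟨_, _, OrthonormalBasis.mk hg htop.ge, ?_, ?_⟩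
  · simpa using hsg
  · simpa using htg

end CommutingOperators

/-! ### Tensor factors as ranges of `*`-homomorphisms. -/

section TensorFactors

variable {d k l : ℕ}

theorem toEuclideanLin_mul (M N : MatAlg d) :
    Matrix.toEuclideanLin (M * N) = Matrix.toEuclideanLin M ∘ₗ Matrix.toEuclideanLin N := by
  ext x i
  simp [Matrix.toLpLin_apply, Matrix.mulVec_mulVec]

theorem toEuclideanLin_star (M : MatAlg d) :
    Matrix.toEuclideanLin (star M) = LinearMap.adjoint (Matrix.toEuclideanLin M) :=
  Matrix.toEuclideanLin_conjTranspose_eq_adjoint M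

theorem toEuclideanLin_conjOp_apply (U : (HilbC k ⊗[ℂ] HilbC l) ≃ₗᵢ[ℂ] HilbC d)
    (T : (HilbC k ⊗[ℂ] HilbC l) →ₗ[ℂ] (HilbC k ⊗[ℂ] HilbC l)) (x : HilbC d) :
    Matrix.toEuclideanLin (conjOp U T) x = U (T (U.symm x)) := by
  rw [conjOp, LinearEquiv.apply_symm_apply]
  rfl

theorem conjOp_mul (U : (HilbC k ⊗[ℂ] HilbC l) ≃ₗᵢ[ℂ] HilbC d)
    (S T : (HilbC k ⊗[ℂ] HilbC l) →ₗ[ℂ] (HilbC k ⊗[ℂ] HilbC l)) :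
    conjOp U (S ∘ₗ T) = conjOp U S * conjOp U T := by
  apply Matrix.toEuclideanLin.injective
  rw [toEuclideanLin_mul]
  refine LinearMap.ext fun x => ?_
  simp [toEuclideanLin_conjOp_apply]

theorem conjOp_adjoint (U : (HilbC k ⊗[ℂ] HilbC l) ≃ₗᵢ[ℂ] HilbC d)
    (T : (HilbC k ⊗[ℂ] HilbC l) →ₗ[ℂ] (HilbC k ⊗[ℂ] HilbC l)) :
    conjOp U (LinearMap.adjoint T) = star (conjOp U T) := by
  apply Matrix.toEuclideanLin.injective
  rw [toEuclideanLin_star, LinearMap.eq_adjoint_iff]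
  intro x y
  rw [toEuclideanLin_conjOp_apply, toEuclideanLin_conjOp_apply,
    LinearIsometryEquiv.inner_map_eq_flip, LinearMap.adjoint_inner_left,
    LinearIsometryEquiv.inner_map_eq_flip, LinearIsometryEquiv.symm_symm]

theorem conjOp_add (U : (HilbC k ⊗[ℂ] HilbC l) ≃ₗᵢ[ℂ] HilbC d)
    (S T : (HilbC k ⊗[ℂ] HilbC l) →ₗ[ℂ] (HilbC k ⊗[ℂ] HilbC l)) :
    conjOp U (S + T) = conjOp U S + conjOp U T := by
  simp [conjOp, LinearMap.add_comp, LinearMap.comp_add]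

theorem conjOp_smul (U : (HilbC k ⊗[ℂ] HilbC l) ≃ₗᵢ[ℂ] HilbC d) (c : ℂ)
    (T : (HilbC k ⊗[ℂ] HilbC l) →ₗ[ℂ] (HilbC k ⊗[ℂ] HilbC l)) :
    conjOp U (c • T) = c • conjOp U T := by
  simp [conjOp, LinearMap.smul_comp, LinearMap.comp_smul]

/-- The `*`-homomorphism `X ↦ U (X ⊗ 𝕀_l) U†`. -/
noncomputable def leftFactorHom (U : (HilbC k ⊗[ℂ] HilbC l) ≃ₗᵢ[ℂ] HilbC d) :
    MatAlg k →⋆ₙₐ[ℂ] MatAlg d where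
  toFun X := conjOp U (TensorProduct.map (Matrix.toEuclideanLin X) LinearMap.id)
  map_smul' c X := by
    simp only [map_smul, TensorProduct.map_smul_left, conjOp_smul, MonoidHom.id_apply]
  map_zero' := by
    rw [map_zero, TensorProduct.map_zero_left]
    simp [conjOp]
  map_add' X Y := by rw [map_add, TensorProduct.map_add_left, conjOp_add]
  map_mul' X Y := by
    rw [← conjOp_mul, ← TensorProduct.map_comp, toEuclideanLin_mul, LinearMap.id_comp]
  map_star' X := by
    rw [← conjOp_adjoint, TensorProduct.adjoint_map, toEuclideanLin_star, LinearMap.adjoint_id]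

/-- The `*`-homomorphism `Y ↦ U (𝕀_k ⊗ Y) U†`. -/
noncomputable def rightFactorHom (U : (HilbC k ⊗[ℂ] HilbC l) ≃ₗᵢ[ℂ] HilbC d) :
    MatAlg l →⋆ₙₐ[ℂ] MatAlg d where
  toFun Y := conjOp U (TensorProduct.map LinearMap.id (Matrix.toEuclideanLin Y))
  map_smul' c X := by
    simp only [map_smul, TensorProduct.map_smul_right, conjOp_smul, MonoidHom.id_apply]
  map_zero' := by
    rw [map_zero, TensorProduct.map_zero_right]
    simp [conjOp]
  map_add' X Y := by rw [map_add, TensorProduct.map_add_right, conjOp_add]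
  map_mul' X Y := by
    rw [← conjOp_mul, ← TensorProduct.map_comp, toEuclideanLin_mul, LinearMap.id_comp]
  map_star' X := by
    rw [← conjOp_adjoint, TensorProduct.adjoint_map, toEuclideanLin_star, LinearMap.adjoint_id]

theorem coe_range_leftFactorHom (U : (HilbC k ⊗[ℂ] HilbC l) ≃ₗᵢ[ℂ] HilbC d) :
    (NonUnitalStarAlgHom.range (leftFactorHom U) : Set (MatAlg d)) = leftFactor U := rfl

theorem coe_range_rightFactorHom (U : (HilbC k ⊗[ℂ] HilbC l) ≃ₗᵢ[ℂ] HilbC d) :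
    (NonUnitalStarAlgHom.range (rightFactorHom U) : Set (MatAlg d)) = rightFactor U := rfl

/-- The unitary map `ℂ^k ⊗ ℂ^l → ℂ^d` given by an orthonormal basis of `ℂ^d` indexed by pairs. -/
noncomputable def unitaryOfBasis (e : OrthonormalBasis (Fin k × Fin l) ℂ (HilbC d)) :
    (HilbC k ⊗[ℂ] HilbC l) ≃ₗᵢ[ℂ] HilbC d :=
  ((EuclideanSpace.basisFun (Fin k) ℂ).tensorProduct (EuclideanSpace.basisFun (Fin l) ℂ)).equiv e
    (Equiv.refl _)

theorem unitaryOfBasis_symm_apply (e : OrthonormalBasis (Fin k × Fin l) ℂ (HilbC d))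
    (i : Fin k) (j : Fin l) :
    (unitaryOfBasis e).symm (e (i, j)) =
      EuclideanSpace.basisFun (Fin k) ℂ i ⊗ₜ EuclideanSpace.basisFun (Fin l) ℂ j := by
  simp [unitaryOfBasis]

theorem unitaryOfBasis_tmul (e : OrthonormalBasis (Fin k × Fin l) ℂ (HilbC d))
    (i : Fin k) (j : Fin l) :
    unitaryOfBasis e
      (EuclideanSpace.basisFun (Fin k) ℂ i ⊗ₜ EuclideanSpace.basisFun (Fin l) ℂ j) = e (i, j) := by
  rw [← unitaryOfBasis_symm_apply, LinearIsometryEquiv.apply_symm_apply]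

theorem toEuclideanLin_basisFun (X : MatAlg k) (i : Fin k) :
    Matrix.toEuclideanLin X (EuclideanSpace.basisFun (Fin k) ℂ i) =
      ∑ m, X m i • EuclideanSpace.basisFun (Fin k) ℂ m := by
  ext n
  simp [Matrix.toLpLin_apply, Pi.single_apply]

theorem leftFactorHom_unitaryOfBasis_eq (e : OrthonormalBasis (Fin k × Fin l) ℂ (HilbC d))
    {a : MatAlg d} {X : MatAlg k}
    (h : ∀ i j, Matrix.toEuclideanLin a (e (i, j)) = ∑ m, X m i • e (m, j)) :
    leftFactorHom (unitaryOfBasis e) X = a := by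
  apply Matrix.toEuclideanLin.injective
  refine e.toBasis.ext ?_
  rintro ⟨i, j⟩
  rw [OrthonormalBasis.coe_toBasis, h]
  refine (toEuclideanLin_conjOp_apply _ _ _).trans ?_
  rw [unitaryOfBasis_symm_apply, TensorProduct.map_tmul, toEuclideanLin_basisFun,
    TensorProduct.sum_tmul, map_sum]
  refine Finset.sum_congr rfl fun m _ => ?_
  rw [← TensorProduct.smul_tmul', map_smul, LinearMap.id_apply, unitaryOfBasis_tmul]

theorem rightFactorHom_unitaryOfBasis_eq (e : OrthonormalBasis (Fin k × Fin l) ℂ (HilbC d))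
    {b : MatAlg d} {Y : MatAlg l}
    (h : ∀ i j, Matrix.toEuclideanLin b (e (i, j)) = ∑ m, Y m j • e (i, m)) :
    rightFactorHom (unitaryOfBasis e) Y = b := by
  apply Matrix.toEuclideanLin.injective
  refine e.toBasis.ext ?_
  rintro ⟨i, j⟩
  rw [OrthonormalBasis.coe_toBasis, h]
  refine (toEuclideanLin_conjOp_apply _ _ _).trans ?_
  rw [unitaryOfBasis_symm_apply, TensorProduct.map_tmul, toEuclideanLin_basisFun,
    TensorProduct.tmul_sum, map_sum]
  refine Finset.sum_congr rfl fun m _ => ?_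
  rw [TensorProduct.tmul_smul, map_smul, LinearMap.id_apply, unitaryOfBasis_tmul]

end TensorFactors

/-! ### Joint irreducibility. -/

section Irreducibility

variable {d : ℕ}

/-- The matrices that leave a subspace invariant together with their adjoints. -/
noncomputable def reducingSubalgebra (S : Submodule ℂ (HilbC d)) :
    NonUnitalStarSubalgebra ℂ (MatAlg d) where
  carrier := {M | (∀ v ∈ S, Matrix.toEuclideanLin M v ∈ S) ∧
    ∀ v ∈ S, Matrix.toEuclideanLin (star M) v ∈ S}
  add_mem' {M N} hM hN := by
    refine ⟨fun v hv => ?_, fun v hv => ?_⟩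
    · rw [map_add]; exact S.add_mem (hM.1 v hv) (hN.1 v hv)
    · rw [star_add, map_add]; exact S.add_mem (hM.2 v hv) (hN.2 v hv)
  zero_mem' := by simp
  mul_mem' {M N} hM hN := by
    refine ⟨fun v hv => ?_, fun v hv => ?_⟩
    · rw [toEuclideanLin_mul]; exact hM.1 _ (hN.1 v hv)
    · rw [star_mul, toEuclideanLin_mul]; exact hN.2 _ (hM.2 v hv)
  smul_mem' c M hM := by
    refine ⟨fun v hv => ?_, fun v hv => ?_⟩
    · rw [map_smul]; exact S.smul_mem _ (hM.1 v hv)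
    · rw [star_smul, map_smul]; exact S.smul_mem _ (hM.2 v hv)
  star_mem' {M} hM := ⟨hM.2, by rw [star_star]; exact hM.1⟩

/-- `ℂ^d` has no proper nonzero subspace invariant under all matrices. -/
theorem eq_top_of_forall_toEuclideanLin_mem {S : Submodule ℂ (HilbC d)} (hS : S ≠ ⊥)
    (h : ∀ M : MatAlg d, ∀ v ∈ S, Matrix.toEuclideanLin M v ∈ S) : S = ⊤ := by
  obtain ⟨x, hx, hx0⟩ := S.ne_bot_iff.1 hS
  refine eq_top_iff.2 fun y _ => ?_
  have hxx : inner ℂ x x ≠ 0 := inner_self_ne_zero.2 hx0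
  -- The rank-one operator `v ↦ ⟨x, v⟩ y` sends `x` to a nonzero multiple of `y`.
  have hy := h (Matrix.toEuclideanLin.symm ((innerₛₗ ℂ x).smulRight y)) x hx
  rw [LinearEquiv.apply_symm_apply] at hy
  exact (S.smul_mem_iff hxx).1 hy

theorem eq_top_of_sup_eq_top {A B : NonUnitalStarSubalgebra ℂ (MatAlg d)} (hAB : A ⊔ B = ⊤)
    {S : Submodule ℂ (HilbC d)} (hS : S ≠ ⊥)
    (hA : ∀ a ∈ A, ∀ v ∈ S, Matrix.toEuclideanLin a v ∈ S)
    (hB : ∀ b ∈ B, ∀ v ∈ S, Matrix.toEuclideanLin b v ∈ S) : S = ⊤ := by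
  have hle : A ⊔ B ≤ reducingSubalgebra S :=
    sup_le (fun a ha => ⟨hA a ha, hA _ (star_mem ha)⟩) (fun b hb => ⟨hB b hb, hB _ (star_mem hb)⟩)
  rw [hAB] at hle
  exact eq_top_of_forall_toEuclideanLin_mem hS fun M => (hle (show M ∈ ⊤ from trivial)).1

end Irreducibility

/-! ### Dimension count and conclusion. -/

/-- A `*`-subalgebra contained in the range of a `*`-homomorphism from a matrix algebra and at
least as large as that algebra is the range, and the homomorphism is injective. -/
theorem eq_range_and_injective_of_finrank_le {d k : ℕ} {A : NonUnitalStarSubalgebra ℂ (MatAlg d)}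
    (f : MatAlg k →⋆ₙₐ[ℂ] MatAlg d) (hA : A ≤ NonUnitalStarAlgHom.range f)
    (hk : k * k ≤ Module.finrank ℂ A) :
    A = NonUnitalStarAlgHom.range f ∧ Function.Injective f := by
  let g : MatAlg k →ₗ[ℂ] MatAlg d := (f : MatAlg k →ₗ[ℂ] MatAlg d)
  have hdom : Module.finrank ℂ (MatAlg k) = k * k := by simp [Module.finrank_matrix]
  have hle : A.toSubmodule ≤ LinearMap.range g := hA
  have hrank := LinearMap.finrank_range_add_finrank_ker g
  have hsub := Submodule.finrank_mono hle
  change k * k ≤ Module.finrank ℂ A.toSubmodule at hk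
  have heq := Submodule.eq_of_le_of_finrank_le hle (by omega)
  refine ⟨SetLike.ext fun x => ?_, show Function.Injective g from
    LinearMap.ker_eq_bot.1 (Submodule.finrank_eq_zero.1 ?_)⟩
  · exact SetLike.ext_iff.1 heq x
  · omega

theorem finrank_le_of_le_range {d k : ℕ} {A : NonUnitalStarSubalgebra ℂ (MatAlg d)}
    (f : MatAlg k →⋆ₙₐ[ℂ] MatAlg d) (hA : A ≤ NonUnitalStarAlgHom.range f) :
    Module.finrank ℂ A ≤ k * k := by
  let g : MatAlg k →ₗ[ℂ] MatAlg d := (f : MatAlg k →ₗ[ℂ] MatAlg d)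
  have hle : A.toSubmodule ≤ LinearMap.range g := hA
  calc Module.finrank ℂ A.toSubmodule ≤ Module.finrank ℂ (LinearMap.range g) :=
        Submodule.finrank_mono hle
    _ ≤ Module.finrank ℂ (MatAlg k) := LinearMap.finrank_range_le g
    _ = k * k := by simp [Module.finrank_matrix]

/-- Commuting `*`-subalgebras that generate `M_d` are contained in the two factors of a tensor
product structure on `ℂ^d`. -/
theorem exists_le_range_factorHom (d : ℕ) (A B : NonUnitalStarSubalgebra ℂ (MatAlg d))
    (hcomm : ∀ a ∈ A, ∀ b ∈ B, a * b = b * a) (hAB : A ⊔ B = ⊤) :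
    ∃ k l : ℕ, d = k * l ∧ (d = 0 → k = 0 ∧ l = 0) ∧
      ∃ U : (HilbC k ⊗[ℂ] HilbC l) ≃ₗᵢ[ℂ] HilbC d,
      A ≤ NonUnitalStarAlgHom.range (leftFactorHom U) ∧
      B ≤ NonUnitalStarAlgHom.range (rightFactorHom U) := by
  suffices ∃ (k l : ℕ) (e : OrthonormalBasis (Fin k × Fin l) ℂ (HilbC d)),
      (d = 0 → k = 0 ∧ l = 0) ∧
      (∀ a ∈ A, ∃ X : MatAlg k, ∀ i j,
        Matrix.toEuclideanLin a (e (i, j)) = ∑ m, X m i • e (m, j)) ∧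
      (∀ b ∈ B, ∃ Y : MatAlg l, ∀ i j,
        Matrix.toEuclideanLin b (e (i, j)) = ∑ m, Y m j • e (i, m)) by
    obtain ⟨k, l, e, h0, hA, hB⟩ := this
    refine ⟨k, l, ?_, h0, unitaryOfBasis e, fun a ha => ?_, fun b hb => ?_⟩
    · have h := Module.finrank_eq_card_basis e.toBasis
      simpa using h
    · obtain ⟨X, hX⟩ := hA a ha
      exact ⟨X, leftFactorHom_unitaryOfBasis_eq e hX⟩
    · obtain ⟨Y, hY⟩ := hB b hb
      exact ⟨Y, rightFactorHom_unitaryOfBasis_eq e hY⟩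
  rcases Nat.eq_zero_or_pos d with rfl | hd
  -- Both factors must vanish when `d = 0`: with `k = 0` and `l = 1` the zero algebra `B` would not
  -- be isomorphic to `M_1`.
  · refine ⟨0, 0, (EuclideanSpace.basisFun (Fin 0) ℂ).reindex (Equiv.equivOfIsEmpty _ _),
      fun _ => ⟨rfl, rfl⟩, fun a _ => ⟨0, fun i => i.elim0⟩, fun b _ => ⟨0, fun i => i.elim0⟩⟩
  · have : Nonempty (Fin d) := ⟨⟨0, hd⟩⟩
    obtain ⟨k, l, e, hA, hB⟩ := exists_orthonormalBasis_prod_of_commute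
      (s := Matrix.toEuclideanLin '' (A : Set (MatAlg d)))
      (t := Matrix.toEuclideanLin '' (B : Set (MatAlg d)))
      (by
        rintro _ ⟨a, ha, rfl⟩
        exact ⟨star a, star_mem ha, toEuclideanLin_star a⟩)
      (by
        rintro _ ⟨a, ha, rfl⟩ _ ⟨b, hb, rfl⟩ x
        rw [← LinearMap.comp_apply, ← LinearMap.comp_apply, ← toEuclideanLin_mul,
          ← toEuclideanLin_mul, hcomm a ha b hb])
      (fun S hS hA hB => eq_top_of_sup_eq_top hAB hS
        (fun a ha => hA _ ⟨a, ha, rfl⟩) (fun b hb => hB _ ⟨b, hb, rfl⟩))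
    exact ⟨k, l, e, fun h => absurd h hd.ne', fun a ha => hA _ ⟨a, ha, rfl⟩,
      fun b hb => hB _ ⟨b, hb, rfl⟩⟩

theorem theorem1 (d : ℕ) (A B : NonUnitalStarSubalgebra ℂ (MatAlg d))
    (independence : ∀ a ∈ A, ∀ b ∈ B, a * b = b * a)
    (tensor_iso : ∃ e : (A ⊗[ℂ] B) →ₙₐ[ℂ] (A ⊔ B : NonUnitalStarSubalgebra ℂ (MatAlg d)),
      Function.Bijective e)
    (completeness : A ⊔ B = ⊤) :
    ∃ k l : ℕ, d = k * l ∧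
      (∃ U : (HilbC k ⊗[ℂ] HilbC l) ≃ₗᵢ[ℂ] HilbC d,
        (A : Set (MatAlg d)) = leftFactor U ∧ (B : Set (MatAlg d)) = rightFactor U) ∧
      Nonempty (A ≃⋆ₐ[ℂ] MatAlg k) ∧ Nonempty (B ≃⋆ₐ[ℂ] MatAlg l) := by
  obtain ⟨e, he⟩ := tensor_iso
  -- Only the dimension equality is taken from the isomorphism.
  have hdim : Module.finrank ℂ A * Module.finrank ℂ B = d * d := by
    let e' := LinearEquiv.ofBijective
      (e : (A ⊗[ℂ] B) →ₗ[ℂ] (A ⊔ B : NonUnitalStarSubalgebra ℂ (MatAlg d))) he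
    have h := e'.finrank_eq
    rw [Module.finrank_tensorProduct] at h
    rw [h, completeness]
    change Module.finrank ℂ (⊤ : Submodule ℂ (MatAlg d)) = _
    simp [Module.finrank_matrix]
  obtain ⟨k, l, hkl, h0, U, hA, hB⟩ := exists_le_range_factorHom d A B independence completeness
  have hA' := finrank_le_of_le_range _ hA
  have hB' := finrank_le_of_le_range _ hB
  obtain ⟨hk, hl⟩ : k * k ≤ Module.finrank ℂ A ∧ l * l ≤ Module.finrank ℂ B := by
    rcases Nat.eq_zero_or_pos d with hd | hd
    · obtain ⟨rfl, rfl⟩ := h0 hd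
      exact ⟨by simp, by simp⟩
    · rw [hkl] at hd
      replace hdim := hdim.trans (congrArg₂ (· * ·) hkl hkl)
      beta_reduce at hdim
      have hk := Nat.pos_of_mul_pos_right hd
      have hl := Nat.pos_of_mul_pos_left hd
      rw [mul_mul_mul_comm] at hdim
      constructor
      -- Cancel `l²` in `k² l² = dim A · dim B ≤ dim A · l²`.
      · refine le_of_mul_le_mul_right (a := l * l) ?_ (Nat.mul_pos hl hl)
        rw [← hdim]
        exact Nat.mul_le_mul_left _ hB'
      · refine le_of_mul_le_mul_left (a := k * k) ?_ (Nat.mul_pos hk hk)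
        rw [← hdim]
        exact Nat.mul_le_mul_right _ hA'
  obtain ⟨hA, hf⟩ := eq_range_and_injective_of_finrank_le _ hA hk
  obtain ⟨hB, hg⟩ := eq_range_and_injective_of_finrank_le _ hB hl
  refine ⟨k, l, hkl, ⟨U, ?_, ?_⟩, ⟨?_⟩, ⟨?_⟩⟩
  · rw [hA, coe_range_leftFactorHom]
  · rw [hB, coe_range_rightFactorHom]
  · rw [hA]
    exact (StarAlgEquiv.ofInjective' _ hf).symm
  · rw [hB]
    exact (StarAlgEquiv.ofInjective' _ hg).symm
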